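/- Let $G$ be a finite, connected, simple graph with vertex set $V$, $n=|V|$. A generalized Laplacian on $G$ is a real symmetric matrix $M\in\mathbb{R}^{V\times V}$ such that $M(u,v)<0$ whenever $\{u,v\}$ is an edge of $G$, and $M(u,v)=0$ whenever $u\neq v$ and $\{u,v\}$ is not an edge. Let $\lambda_1\le\lambda_2\le\cdots\le\lambda_n$ be its eigenvalues, counted with multiplicity, and put $E(M,\lambda)=\ker(M-\lambda I)$. For a nowhere zero function $g\colon V\to\mathbb{R}$, its number of nodal domains is the number of connected components of the subgraph of $G$ induced on $\{v: g(v)>0\}$ plus the number of connected components of the subgraph induced on $\{v: g(v)<0\}$. A signing of $f\colon V\to\mathbb{R}$ is a nowhere zero function $g\colon V\to\mathbb{R}$ with $g(v)>0$ whenever $f(v)>0$ and $g(v)<0$ whenever $f(v)<0$. The Urschel number $\mathrm{UN}(f)$ is the minimum, over all signings $g$ of $f$, of the number of nodal domains of $g$. Theorem. Let $M$ be a generalized Laplacian on $G$, and let $\lambda_k$ be an eigenvalue of $M$ of multiplicity $m\ge 1$, so that $$\lambda_{k-1}<\lambda_k=\lambda_{k+1}=\cdots=\lambda_{k+m-1}<\lambda_{k+m},$$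 where the first inequality is omitted if $k=1$ and the last one if $k+m-1=n$. Then $E(M,\lambda_k)$ has an orthonormal basis $f_k,f_{k+1},\ldots,f_{k+m-1}$ such that $$\mathrm{UN}(f_{k+j})\le k+\min(j,\,m-1-j)\qquad\text{for all } 0\le j\le m-1.$$ -/

import Mathlib

/-- A generalized Laplacian on `G`: a symmetric real matrix supported on `G`, with strictly
negative entries on the edges of `G` (the diagonal is arbitrary). -/
structure IsGeneralizedLaplacian {V : Type*} (G : SimpleGraph V) (M : Matrix V V ℝ) : Prop where
  symm : M.IsSymm
  supported : ∀ u v, M u v ≠ 0 → u = v ∨ G.Adj u v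
  neg_of_adj : ∀ u v, G.Adj u v → M u v < 0

theorem IsGeneralizedLaplacian.isHermitian {V : Type*} {G : SimpleGraph V} {M : Matrix V V ℝ}
    (hM : IsGeneralizedLaplacian G M) : M.IsHermitian := by
  rw [Matrix.IsHermitian, Matrix.conjTranspose_eq_transpose_of_trivial]
  exact hM.symm

/-- The `i`-th smallest eigenvalue `λ_i`, for `1 ≤ i ≤ n = |V|`, of a real symmetric matrix: the
eigenvalues are counted with multiplicity and ordered as `λ_1 ≤ λ_2 ≤ ⋯ ≤ λ_n`. (Mathlib's
`eigenvalues₀` lists them in non-increasing order, indexed from `0`.) The value outside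
the range `1 ≤ i ≤ n` is irrelevant. -/
noncomputable def nthEigenvalue {V : Type*} [Fintype V] [DecidableEq V] {M : Matrix V V ℝ}
    (hM : M.IsHermitian) (i : ℕ) : ℝ :=
  if h : 1 ≤ i ∧ i ≤ Fintype.card V then
    hM.eigenvalues₀ ⟨Fintype.card V - i, by omega⟩
  else 0

/-- The eigenspace `E(M, μ) = ker (M - μ I)`, as a subspace of Euclidean space `ℝ^V`. -/
noncomputable def matrixEigenspace {V : Type*} [Fintype V] [DecidableEq V] (M : Matrix V V ℝ)
    (μ : ℝ) : Submodule ℝ (EuclideanSpace ℝ V) :=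
  Module.End.eigenspace (Matrix.toEuclideanLin M) μ

/-- The strong nodal domain number: the number of connected components of the subgraph induced
on `{f > 0}` plus the number of those of the subgraph induced on `{f < 0}`. -/
noncomputable def strongNodalDomainNumber {V : Type*} (G : SimpleGraph V) (f : V → ℝ) : ℕ :=
  Nat.card (G.induce {v | 0 < f v}).ConnectedComponent +
    Nat.card (G.induce {v | f v < 0}).ConnectedComponent

/-- A signing of `f`: a nowhere zero function with the sign of `f` wherever `f` is nonzero. -/
structure IsSigning {V : Type*} (f g : V → ℝ) : Prop where
  pos : ∀ v, 0 < f v → 0 < g v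
  neg : ∀ v, f v < 0 → g v < 0
  ne_zero : ∀ v, g v ≠ 0

theorem exists_isSigning {V : Type*} (f : V → ℝ) : ∃ g, IsSigning f g := by
  classical
  refine ⟨fun v => if f v < 0 then -1 else 1, ⟨fun v hv => ?_, fun v hv => ?_, fun v => ?_⟩⟩
  · simp [not_lt.mpr hv.le]
  · simp [hv]
  · split_ifs <;> norm_num

/-- The Urschel number of `f`: the least strong nodal domain number of a signing of `f`.
(A signing always exists, so the infimum is a minimum; a signing is nowhere zero, so its weak and
strong nodal domains coincide.) -/
noncomputable def urschelNumber {V : Type*} (G : SimpleGraph V) (f : V → ℝ) : ℕ :=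
  sInf {d : ℕ | ∃ g : V → ℝ, IsSigning f g ∧ d = strongNodalDomainNumber G g}

open Matrix Module

/-! ### A nodal domain bound for null vectors, zeros included. -/

section UrschelBound

variable {V : Type*}

/-! A Courant-type bound says that the Urschel number of an eigenvector is at most the number of
eigenvalues not exceeding its own (`urschelNumber_eigenvector_add_card_le`). For λ_k this gives only
k+m-1, and the improvement comes from breaking the multiplicity.

Choose m vertices p_0, …, p_{m-1} whose evaluations determine the vectors of E(M, λ_k), with dual
basis h_i. Add σ t, σ t², …, σ t^m to the diagonal at these vertices and let t → 0. The eigenvectors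
subconverge to an orthonormal eigenbasis of M, whose members in E(M, λ_k) can be labelled F_0, …,
F_{m-1} so that the eigenvalue leading to F_j is λ_k + σ F_j(p_j)² t^{j+1} to leading order. For σ =
1 the eigenvalues leading to the F_i with i < j lie above that of F_j; for σ = -1 those with i > j
do. Urschel numbers do not increase in the limit, so the bounds are k+m-1-j and k+j respectively.

Moreover F_j vanishes at p_i for i < j and is orthogonal to h_i for i > j. This fixes F_j up to a
scalar, whatever the sign of σ, so one basis obeys both bounds (`exists_limit_eigenvectors`).

For the Courant-type bound, small diagonal perturbations of the matrix remove the zeros of a null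
vector without changing its other signs. Once it is nowhere zero, scaling it separately on each
nodal domain gives a space on which the form is nonpositive, and this space meets a positive
definite one trivially. -/

theorem urschelNumber_le_of_isSigning {G : SimpleGraph V} {f g : V → ℝ} (h : IsSigning f g) :
    urschelNumber G f ≤ strongNodalDomainNumber G g :=
  Nat.sInf_le ⟨g, h, rfl⟩

/-- Refining the sign pattern of a function does not decrease its Urschel number. -/
theorem urschelNumber_le_of_sign_compatible {G : SimpleGraph V} {f g : V → ℝ}
    (hpos : ∀ v, 0 < f v → 0 < g v) (hneg : ∀ v, f v < 0 → g v < 0) :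
    urschelNumber G f ≤ urschelNumber G g := by
  obtain ⟨s, hs, hd⟩ := Nat.sInf_mem (s := {d : ℕ | ∃ s : V → ℝ, IsSigning g s ∧
    d = strongNodalDomainNumber G s})
    ((exists_isSigning g).elim fun s hs => ⟨_, s, hs, rfl⟩)
  rw [urschelNumber.eq_1 G g, hd]
  exact urschelNumber_le_of_isSigning
    ⟨fun v hv => hs.pos v (hpos v hv), fun v hv => hs.neg v (hneg v hv), hs.ne_zero⟩

/-- The nodal domains of `g`, positive and negative ones. -/
abbrev NodalDomain (G : SimpleGraph V) (g : V → ℝ) : Type _ :=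
  (G.induce {v | 0 < g v}).ConnectedComponent ⊕ (G.induce {v | g v < 0}).ConnectedComponent

open Classical in
/-- The nodal domain containing a given vertex of a nowhere zero function. -/
noncomputable def nodalDomainMk (G : SimpleGraph V) {g : V → ℝ} (hg : ∀ v, g v ≠ 0) (v : V) :
    NodalDomain G g :=
  if h : 0 < g v then Sum.inl ((G.induce {v | 0 < g v}).connectedComponentMk ⟨v, h⟩)
  else Sum.inr ((G.induce {v | g v < 0}).connectedComponentMk
    ⟨v, lt_of_le_of_ne (not_lt.mp h) (hg v)⟩)

theorem nodalDomainMk_surjective (G : SimpleGraph V) {g : V → ℝ} (hg : ∀ v, g v ≠ 0) :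
    Function.Surjective (nodalDomainMk G hg) := by
  rintro (c | c)
  · induction c using SimpleGraph.ConnectedComponent.ind with | _ v
    exact ⟨v.1, by rw [nodalDomainMk, dif_pos (show 0 < g v.1 from v.2)]⟩
  · induction c using SimpleGraph.ConnectedComponent.ind with | _ v
    exact ⟨v.1, by rw [nodalDomainMk, dif_neg (not_lt.mpr (le_of_lt v.2))]⟩

theorem nodalDomainMk_eq_of_adj {G : SimpleGraph V} {g : V → ℝ} (hg : ∀ v, g v ≠ 0) {u v : V}
    (huv : G.Adj u v) (h : 0 < g u * g v) : nodalDomainMk G hg u = nodalDomainMk G hg v := by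
  rcases pos_and_pos_or_neg_and_neg_of_mul_pos h with ⟨hu, hv⟩ | ⟨hu, hv⟩
  · rw [nodalDomainMk, nodalDomainMk, dif_pos hu, dif_pos hv]
    congr 1
    exact SimpleGraph.ConnectedComponent.sound (SimpleGraph.Adj.reachable (by simpa using huv))
  · rw [nodalDomainMk, nodalDomainMk, dif_neg hu.not_gt, dif_neg hv.not_gt]
    congr 1
    exact SimpleGraph.ConnectedComponent.sound (SimpleGraph.Adj.reachable (by simpa using huv))

theorem SimpleGraph.Connected.exists_adj_mem_notMem {G : SimpleGraph V} (hG : G.Connected)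
    {S : Set V} {a b : V} (ha : a ∈ S) (hb : b ∉ S) : ∃ u v, G.Adj u v ∧ u ∈ S ∧ v ∉ S := by
  obtain ⟨p⟩ := hG.preconnected a b
  obtain ⟨d, -, h1, h2⟩ := p.exists_boundary_dart S ha hb
  exact ⟨_, _, d.adj, h1, h2⟩

theorem IsGeneralizedLaplacian.add_diagonal [DecidableEq V] {G : SimpleGraph V}
    {M : Matrix V V ℝ} (hM : IsGeneralizedLaplacian G M) (d : V → ℝ) :
    IsGeneralizedLaplacian G (M + diagonal d) where
  symm := hM.symm.add (isSymm_diagonal d)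
  supported u v h := by
    by_cases huv : u = v
    · exact .inl huv
    · exact hM.supported u v (by simpa [huv] using h)
  neg_of_adj u v h := by simpa [h.ne] using hM.neg_of_adj u v h

variable [Fintype V]

/-- If `g` is in the kernel of the symmetric matrix `N`, then the quadratic form of `N` at `c g`
is a weighted sum of squares of differences of `c`. -/
theorem dotProduct_mulVec_mul_of_mulVec_eq_zero {N : Matrix V V ℝ} (hN : N.IsSymm) {g : V → ℝ}
    (hNg : N *ᵥ g = 0) (c : V → ℝ) :
    2 * ((fun v => c v * g v) ⬝ᵥ N *ᵥ fun v => c v * g v) =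
      -∑ u, ∑ v, N u v * (g u * g v) * (c u - c v) ^ 2 := by
  have row : ∀ u, ∑ v, N u v * g v = 0 := fun u => congrFun hNg u
  have h1 : ∑ u, ∑ v, c u ^ 2 * g u * (N u v * g v) = 0 :=
    Finset.sum_eq_zero fun u _ => by rw [← Finset.mul_sum, row, mul_zero]
  have h2 : ∑ u, ∑ v, c v ^ 2 * g v * (N u v * g u) = 0 := by
    rw [Finset.sum_comm]
    refine Finset.sum_eq_zero fun v _ => ?_
    rw [← Finset.mul_sum, ← row v]
    simp only [hN.apply, row, mul_zero]
  have h3 : ((fun v => c v * g v) ⬝ᵥ N *ᵥ fun v => c v * g v) =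
      ∑ u, ∑ v, c u * g u * (N u v * (c v * g v)) := by
    simp only [dotProduct, mulVec, Finset.mul_sum]
  -- Of the expanded square only the cross term survives: each pure square carries a factor (N g)(u)
  -- = 0.
  have h4 : ∑ u, ∑ v, N u v * (g u * g v) * (c u - c v) ^ 2 =
      ∑ u, ∑ v, c u ^ 2 * g u * (N u v * g v) + ∑ u, ∑ v, c v ^ 2 * g v * (N u v * g u) -
        2 * ∑ u, ∑ v, c u * g u * (N u v * (c v * g v)) := by
    simp only [Finset.mul_sum, ← Finset.sum_add_distrib, ← Finset.sum_sub_distrib]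
    exact Finset.sum_congr rfl fun u _ => Finset.sum_congr rfl fun v _ => by ring
  rw [h3, h4, h1, h2]
  ring

/-- A nowhere zero null vector has no more nodal domains than the codimension of any subspace
on which the form is positive definite. -/
theorem strongNodalDomainNumber_add_finrank_le {G : SimpleGraph V} {N : Matrix V V ℝ}
    (hN : IsGeneralizedLaplacian G N) {g : V → ℝ} (hg : ∀ v, g v ≠ 0) (hNg : N *ᵥ g = 0)
    (W : Submodule ℝ (V → ℝ)) (hW : ∀ x ∈ W, x ≠ 0 → 0 < x ⬝ᵥ N *ᵥ x) :
    strongNodalDomainNumber G g + finrank ℝ W ≤ Fintype.card V := by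
  have hcard : strongNodalDomainNumber G g = Nat.card (NodalDomain G g) :=
    (Nat.card_sum).symm
  have : Finite (NodalDomain G g) := Finite.of_surjective _ (nodalDomainMk_surjective G hg)
  have := Fintype.ofFinite (NodalDomain G g)
  let T : (NodalDomain G g → ℝ) →ₗ[ℝ] (V → ℝ) :=
    { toFun := fun c v => c (nodalDomainMk G hg v) * g v
      map_add' := fun c d => by ext v; simp [add_mul]
      map_smul' := fun a c => by ext v; simp [mul_assoc] }
  have hT : Function.Injective T := by
    intro c d hcd
    ext K
    obtain ⟨v, rfl⟩ := nodalDomainMk_surjective G hg K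
    exact mul_right_cancel₀ (hg v) (congrFun hcd v)
  have hdisj : Disjoint (LinearMap.range T) W := by
    rw [Submodule.disjoint_def]
    rintro _ ⟨c, rfl⟩ hx
    by_contra hne
    have hpos := hW _ hx hne
    have hform := dotProduct_mulVec_mul_of_mulVec_eq_zero hN.symm hNg
      (fun v => c (nodalDomainMk G hg v))
    -- An edge whose ends have equal signs stays in one nodal domain, so its difference of `c`
    -- vanishes; on any other edge both `N u v` and `g u * g v` are nonpositive.
    have hnonneg : 0 ≤ ∑ u, ∑ v, N u v * (g u * g v) *
        (c (nodalDomainMk G hg u) - c (nodalDomainMk G hg v)) ^ 2 := by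
      refine Finset.sum_nonneg fun u _ => Finset.sum_nonneg fun v _ => ?_
      by_cases h0 : N u v = 0
      · simp [h0]
      rcases hN.supported u v h0 with rfl | hadj
      · simp
      rcases lt_or_ge 0 (g u * g v) with h | h
      · simp [nodalDomainMk_eq_of_adj hg hadj h]
      · exact mul_nonneg (mul_nonneg_of_nonpos_of_nonpos (hN.neg_of_adj u v hadj).le h)
          (sq_nonneg _)
    change 0 < ((fun v => c (nodalDomainMk G hg v) * g v) ⬝ᵥ
      N *ᵥ fun v => c (nodalDomainMk G hg v) * g v) at hpos
    linarith
  have := Submodule.finrank_add_finrank_le_of_disjoint hdisj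
  rw [LinearMap.finrank_range_of_inj hT, finrank_fintype_fun_eq_card, finrank_fintype_fun_eq_card]
    at this
  rwa [hcard, Nat.card_eq_fintype_card]

/-- If a symmetric matrix links a coordinate outside `Z` to one in `Z`, some vector does not vanish
on `Z` although its image does. -/
theorem exists_mulVec_eq_zero_on_and_ne_zero [DecidableEq V] {N : Matrix V V ℝ} (hN : N.IsSymm)
    (Z : Set V) {u v : V} (hu : u ∉ Z) (hv : v ∈ Z) (huv : N u v ≠ 0) :
    ∃ h : V → ℝ, (∀ w ∈ Z, (N *ᵥ h) w = 0) ∧ ∃ w ∈ Z, h w ≠ 0 := by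
  by_contra! hcon
  let S : Submodule ℝ (V → ℝ) :=
    { carrier := {x | ∀ w, w ∉ Z → x w = 0}
      add_mem' := fun ha hb w hw => by simp [ha w hw, hb w hw]
      zero_mem' := fun _ _ => rfl
      smul_mem' := fun a x hx w hw => by simp [hx w hw] }
  -- By the contrary assumption, the rows of `N` indexed by `Z` have common kernel inside that of
  -- each coordinate in `Z`, so they span these coordinates. Symmetry turns rows into columns.
  have hS : S ≤ S.map N.mulVecLin := by
    have hsingle : ∀ w ∈ Z, (Pi.single w 1 : V → ℝ) ∈ S.map N.mulVecLin := by
      intro w hw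
      have hmem : (LinearMap.proj w : (V → ℝ) →ₗ[ℝ] ℝ) ∈ Submodule.span ℝ (Set.range fun z : Z =>
          (LinearMap.proj (z : V) : (V → ℝ) →ₗ[ℝ] ℝ) ∘ₗ N.mulVecLin) := by
        refine mem_span_of_iInf_ker_le_ker fun x hx => ?_
        simp only [Submodule.mem_iInf, LinearMap.mem_ker, LinearMap.comp_apply,
          LinearMap.proj_apply, mulVecLin_apply] at hx ⊢
        exact hcon x (fun z hz => hx ⟨z, hz⟩) w hw
      have := Fintype.ofFinite Z
      obtain ⟨y, hy⟩ := (Submodule.mem_span_range_iff_exists_fun ℝ).mp hmem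
      refine ⟨∑ z : Z, y z • Pi.single (z : V) 1, ?_, ?_⟩
      · refine Submodule.sum_mem _ fun z _ => Submodule.smul_mem _ _ fun w hw => ?_
        exact Pi.single_eq_of_ne (fun h : w = z => hw (h ▸ z.2)) _
      · ext x
        have := LinearMap.congr_fun hy (Pi.single x 1)
        simp only [LinearMap.sum_apply, LinearMap.smul_apply, LinearMap.comp_apply,
          LinearMap.proj_apply, mulVecLin_apply, mulVec_single_one, col_apply] at this
        simp only [map_sum, map_smul, mulVecLin_apply, mulVec_single_one, Finset.sum_apply,
          Pi.smul_apply, col_apply]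
        rw [Pi.single_comm, ← this]
        exact Finset.sum_congr rfl fun z _ => by rw [hN.apply]
    intro x hx
    have hxs : x = ∑ w, x w • (Pi.single w 1 : V → ℝ) := pi_eq_sum_univ' x
    rw [hxs]
    refine Submodule.sum_mem _ fun w _ => ?_
    by_cases hw : w ∈ Z
    · exact Submodule.smul_mem _ _ (hsingle w hw)
    · rw [hx w hw, zero_smul]
      exact Submodule.zero_mem _
  -- Equality of dimensions makes `S` invariant under `N`, which the entry `N u v` forbids.
  have heq : S = S.map N.mulVecLin :=
    Submodule.eq_of_le_of_finrank_le hS (Submodule.finrank_map_le _ _)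
  have hvS : (Pi.single v 1 : V → ℝ) ∈ S := fun w hw =>
    Pi.single_eq_of_ne (fun h : w = v => hw (h ▸ hv)) _
  have : N.mulVecLin (Pi.single v 1) ∈ S := by
    rw [heq]
    exact Submodule.mem_map_of_mem hvS
  exact huv (by simpa using this u hu)

theorem dotProduct_diagonal_mulVec [DecidableEq V] (d x : V → ℝ) :
    x ⬝ᵥ diagonal d *ᵥ x = ∑ v, d v * x v ^ 2 := by
  simp only [dotProduct, mulVec_diagonal]
  exact Finset.sum_congr rfl fun v _ => by ring

/-- A null vector with zeros can be perturbed, along with the matrix, to a null vector with fewer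
zeros. -/
theorem exists_perturbation_fewer_zeros [DecidableEq V] {G : SimpleGraph V} (hG : G.Connected)
    {N : Matrix V V ℝ} (hN : IsGeneralizedLaplacian G N) {f : V → ℝ} (hNf : N *ᵥ f = 0)
    {a b : V} (ha : f a ≠ 0) (hb : f b = 0) {δ : ℝ} (hδ : 0 < δ) :
    ∃ d g : V → ℝ, (∀ v, |d v| ≤ δ) ∧ (N + diagonal d) *ᵥ g = 0 ∧ (∀ v, 0 < f v → 0 < g v) ∧
      (∀ v, f v < 0 → g v < 0) ∧ ∃ w, f w = 0 ∧ g w ≠ 0 := by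
  obtain ⟨u, v, hadj, hu, hv⟩ := hG.exists_adj_mem_notMem (S := {w | f w ≠ 0}) ha
    (by simpa using hb)
  obtain ⟨h, hZ, w, hw, hhw⟩ := exists_mulVec_eq_zero_on_and_ne_zero hN.symm {w | f w = 0}
    (u := u) (v := v) hu (by simpa using hv) (hN.neg_of_adj u v hadj).ne
  have hev : ∀ᶠ ε : ℝ in nhds 0, ∀ v, f v ≠ 0 →
      0 < (f v + ε * h v) * f v ∧ |-(ε * (N *ᵥ h) v) / (f v + ε * h v)| < δ := by
    rw [Filter.eventually_all]
    intro v
    rw [Filter.eventually_imp_distrib_left]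
    intro hfv
    have h1 : Filter.Tendsto (fun ε : ℝ => (f v + ε * h v) * f v) (nhds 0)
        (nhds ((f v + 0 * h v) * f v)) := (by fun_prop : Continuous _).tendsto 0
    have h2 : Filter.Tendsto (fun ε : ℝ => |-(ε * (N *ᵥ h) v) / (f v + ε * h v)|) (nhds 0)
        (nhds |-(0 * (N *ᵥ h) v) / (f v + 0 * h v)|) :=
      ((by fun_prop : Continuous fun ε : ℝ => -(ε * (N *ᵥ h) v)).continuousAt.div
        (by fun_prop) (by simpa using hfv)).abs
    refine (h1.eventually (lt_mem_nhds ?_)).and (h2.eventually (gt_mem_nhds ?_))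
    · simpa using mul_self_pos.mpr hfv
    · simpa using hδ
  obtain ⟨ε, hε, hε0⟩ := ((hev.filter_mono nhdsWithin_le_nhds).and
    (self_mem_nhdsWithin : {0}ᶜ ∈ nhdsWithin (0 : ℝ) {0}ᶜ)).exists
  -- With g = f + ε h, the diagonal entry -(N g)(v) / g(v) is forced wherever f(v) ≠ 0. At the zeros
  -- of f, N g already vanishes, so no correction is needed there.
  refine ⟨fun v => if f v = 0 then 0 else -(ε * (N *ᵥ h) v) / (f v + ε * h v),
    f + ε • h, fun v => ?_, ?_, fun v hv => ?_, fun v hv => ?_, w, hw, ?_⟩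
  · dsimp only
    split_ifs with hfv
    · simpa using hδ.le
    · exact (hε v hfv).2.le
  · ext v
    rw [add_mulVec, mulVec_add, mulVec_smul, hNf, zero_add, Pi.add_apply, mulVec_diagonal]
    by_cases hfv : f v = 0
    · simp [hfv, hZ v hfv]
    · have : f v + ε * h v ≠ 0 := left_ne_zero_of_mul (hε v hfv).1.ne'
      simp only [if_neg hfv, Pi.add_apply, Pi.smul_apply, smul_eq_mul, Pi.zero_apply]
      field_simp
      ring
  · exact pos_of_mul_pos_left (hε v hv.ne').1 hv.le
  · exact neg_of_mul_pos_left (hε v hv.ne).1 hv.le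
  · have hw' : f w = 0 := hw
    simpa [hw'] using ⟨hε0, hhw⟩

/-- The Urschel number of a null vector is at most the codimension of any subspace on which the
form is positive definite. -/
theorem urschelNumber_add_finrank_le [DecidableEq V] {G : SimpleGraph V} (hG : G.Connected)
    {N : Matrix V V ℝ} (hN : IsGeneralizedLaplacian G N) {f : V → ℝ} (hf : f ≠ 0)
    (hNf : N *ᵥ f = 0) (W : Submodule ℝ (V → ℝ)) {c : ℝ} (hc : 0 < c)
    (hW : ∀ x ∈ W, c * (x ⬝ᵥ x) ≤ x ⬝ᵥ N *ᵥ x) :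
    urschelNumber G f + finrank ℝ W ≤ Fintype.card V := by
  -- Induction on the number of zeros. The uniform constant `c` leaves room for diagonal entries of
  -- size at most c/2, after which the form is still bounded below with constant c/2.
  induction hz : (Finset.univ.filter fun v => f v = 0).card using Nat.strong_induction_on
    generalizing N f c with | _ z ih
  by_cases hne : ∀ v, f v ≠ 0
  · refine (Nat.add_le_add_right (urschelNumber_le_of_isSigning (g := f) ⟨fun _ h => h,
      fun _ h => h, hne⟩) _).trans (strongNodalDomainNumber_add_finrank_le hN hne hNf W ?_)
    intro x hx hx0
    have : 0 < x ⬝ᵥ x := by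
      refine lt_of_le_of_ne (Finset.sum_nonneg fun v _ => mul_self_nonneg _) fun h => hx0 ?_
      exact dotProduct_self_eq_zero.mp h.symm
    exact (mul_pos hc this).trans_le (hW x hx)
  · push Not at hne
    obtain ⟨b, hb⟩ := hne
    obtain ⟨a, ha⟩ := Function.ne_iff.mp hf
    obtain ⟨d, g, hd, hg, hp, hn, w, hfw, hgw⟩ :=
      exists_perturbation_fewer_zeros hG hN hNf ha hb (half_pos hc)
    refine (Nat.add_le_add_right (urschelNumber_le_of_sign_compatible hp hn) _).trans
      (ih _ ?_ (hN.add_diagonal d) (fun h => hgw (congrFun h w)) hg (half_pos hc) ?_ rfl)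
    · rw [← hz]
      refine Finset.card_lt_card ⟨fun v hv => ?_, fun hsub => hgw ?_⟩
      · simp only [Finset.mem_filter, Finset.mem_univ, true_and] at hv ⊢
        by_contra h
        rcases lt_or_gt_of_ne h with h | h
        · exact (hn v h).ne hv
        · exact (hp v h).ne' hv
      · simpa using hsub (show w ∈ _ by simpa using hfw)
    · intro x hx
      rw [add_mulVec, dotProduct_add, dotProduct_diagonal_mulVec]
      have h1 := hW x hx
      have h2 : -(c / 2 * (x ⬝ᵥ x)) ≤ ∑ v, d v * x v ^ 2 := by
        rw [dotProduct, Finset.mul_sum, ← Finset.sum_neg_distrib]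
        refine Finset.sum_le_sum fun v _ => ?_
        nlinarith [mul_le_mul_of_nonneg_right (neg_le_of_abs_le (hd v)) (sq_nonneg (x v))]
      linarith

end UrschelBound

/-! ### Interpolation points, limits of eigenbases, and eigenvalue counts. -/

section Eigenbasis

variable {V : Type*} [Fintype V]

/-- A finite-dimensional space of functions is determined by its values at `finrank` many points,
and there is a basis dual to the evaluations at these points. -/
theorem exists_interpolation_basis {E : Type*} [AddCommGroup E] [Module ℝ E]
    [FiniteDimensional ℝ E] {m : ℕ} (hm : finrank ℝ E = m) (T : E →ₗ[ℝ] (V → ℝ))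
    (hT : Function.Injective T) :
    ∃ (p : Fin m → V) (h : Fin m → E), (∀ i l, T (h i) (p l) = if i = l then 1 else 0) ∧
      ∀ x, x = ∑ i, T x (p i) • h i := by
  let ev : V → E →ₗ[ℝ] ℝ := fun v => LinearMap.proj v ∘ₗ T
  have hker : ∀ x, (∀ v, ev v x = 0) → x = 0 := fun x hx =>
    hT (by rw [map_zero]; exact funext hx)
  have hspan : ⊤ ≤ Submodule.span ℝ (Set.range ev) := by
    intro φ _
    refine mem_span_of_iInf_ker_le_ker fun x hx => ?_
    simp only [Submodule.mem_iInf, LinearMap.mem_ker] at hx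
    rw [LinearMap.mem_ker, hker x hx, map_zero]
  -- The evaluations span the dual space, so some of them form a basis of it; their vertices are the
  -- interpolation points.
  obtain ⟨κ, a, -, hsp, hli⟩ := exists_linearIndependent' ℝ ev
  let b : Basis κ ℝ (E →ₗ[ℝ] ℝ) := Basis.mk hli (hsp ▸ hspan)
  have : Finite κ := Module.Finite.finite_basis b
  have := Fintype.ofFinite κ
  have hcard : Fintype.card κ = m := by
    rw [← finrank_eq_card_basis b, ← hm]
    exact Subspace.dual_finrank_eq
  let e : Fin m ≃ κ := (Fintype.equivFinOfCardEq hcard).symm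
  let R : E →ₗ[ℝ] (Fin m → ℝ) := LinearMap.pi fun i => ev (a (e i))
  have hR : Function.Injective R := by
    rw [injective_iff_map_eq_zero]
    intro x hx
    refine hker x fun v => ?_
    have hle : Submodule.span ℝ (Set.range (ev ∘ a)) ≤ LinearMap.ker (Dual.eval ℝ E x) := by
      rw [Submodule.span_le]
      rintro _ ⟨i, rfl⟩
      have := congrFun hx (e.symm i)
      simpa [R] using this
    have hev : ev v ∈ Submodule.span ℝ (Set.range (ev ∘ a)) := hsp ▸ hspan Submodule.mem_top
    exact hle hev
  have hdim : finrank ℝ E = finrank ℝ (Fin m → ℝ) := by simp [hm]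
  let L : E ≃ₗ[ℝ] (Fin m → ℝ) := LinearEquiv.ofInjectiveOfFinrankEq R hR hdim
  have hL : ∀ x i, L x i = T x (a (e i)) := fun x i => rfl
  have hδ : ∀ i l, T (L.symm (Pi.single i 1)) (a (e l)) = if i = l then 1 else 0 := fun i l => by
    rw [← hL, LinearEquiv.apply_symm_apply, Pi.single_apply]
    simp only [eq_comm]
  refine ⟨fun i => a (e i), fun i => L.symm (Pi.single i 1), hδ, fun x => ?_⟩
  apply L.injective
  ext l
  rw [hL, hL]
  simp [hδ]

theorem dotProduct_mulVec_comm {A : Matrix V V ℝ} (hA : A.IsSymm) (x y : V → ℝ) :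
    x ⬝ᵥ A *ᵥ y = (A *ᵥ x) ⬝ᵥ y := by
  rw [dotProduct_mulVec, ← mulVec_transpose, hA.eq]

variable [DecidableEq V]

theorem roots_charpoly_eq_of_orthonormal_eigenvectors {A : Matrix V V ℝ} {U : V → V → ℝ}
    {μ : V → ℝ} (hU : ∀ i j, U i ⬝ᵥ U j = if i = j then 1 else 0)
    (hA : ∀ i, A *ᵥ U i = μ i • U i) : A.charpoly.roots = Finset.univ.val.map μ := by
  let Q : Matrix V V ℝ := (of U)ᵀ
  have h1 : Qᵀ * Q = 1 := by
    ext i j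
    simpa [Matrix.mul_apply, Matrix.one_apply, Q, dotProduct] using hU i j
  have h2 : A * Q = Q * diagonal μ := by
    ext v i
    rw [mul_diagonal]
    have := congrFun (hA i) v
    simpa [Matrix.mul_apply, mulVec, dotProduct, Q, mul_comm] using this
  have h3 : A = Q * diagonal μ * Qᵀ := by
    rw [← h2, Matrix.mul_assoc, mul_eq_one_comm.mp h1, Matrix.mul_one]
  rw [h3, charpoly_mul_comm, ← Matrix.mul_assoc, h1, Matrix.one_mul, charpoly_diagonal]
  exact Polynomial.roots_multiset_prod_X_sub_C (Finset.univ.val.map μ) |>.symm ▸ by simp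

/-- Both lists are the roots of the characteristic polynomial. Hence an eigenbasis obtained as a
limit, with no prescribed order, still has the right counts. -/
theorem card_filter_eigenvalues₀ {A : Matrix V V ℝ} (hA : A.IsHermitian) {U : V → V → ℝ}
    {μ : V → ℝ} (hU : ∀ i j, U i ⬝ᵥ U j = if i = j then 1 else 0)
    (hAU : ∀ i, A *ᵥ U i = μ i • U i) (P : ℝ → Prop) [DecidablePred P] :
    (Finset.univ.filter fun i => P (μ i)).card =
      (Finset.univ.filter fun i => P (hA.eigenvalues₀ i)).card := by
  have h := (roots_charpoly_eq_of_orthonormal_eigenvectors hU hAU).symm.trans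
    hA.roots_charpoly_eq_eigenvalues₀
  have h' := congrArg (Multiset.countP P) h
  rw [Multiset.countP_map, Multiset.countP_map] at h'
  exact h'

theorem exists_orthonormal_eigenvectors {A : Matrix V V ℝ} (hA : A.IsHermitian) :
    ∃ (U : V → V → ℝ) (μ : V → ℝ), (∀ i j, U i ⬝ᵥ U j = if i = j then 1 else 0) ∧
      ∀ i, A *ᵥ U i = μ i • U i := by
  refine ⟨fun i => (hA.eigenvectorBasis i).ofLp, hA.eigenvalues, fun i j => ?_,
    hA.mulVec_eigenvectorBasis⟩
  have := orthonormal_iff_ite.mp hA.eigenvectorBasis.orthonormal j i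
  rw [EuclideanSpace.inner_eq_star_dotProduct] at this
  simpa [eq_comm] using this

/-- Orthonormal eigenbases of a convergent sequence of symmetric matrices subconverge to an
orthonormal eigenbasis of the limit. -/
theorem exists_subseq_tendsto_eigenvectors {A : ℕ → Matrix V V ℝ} {B : Matrix V V ℝ}
    (hA : ∀ n, (A n).IsHermitian) (hAB : Filter.Tendsto A Filter.atTop (nhds B)) :
    ∃ φ : ℕ → ℕ, StrictMono φ ∧ ∃ (u : ℕ → V → V → ℝ) (ν : ℕ → V → ℝ) (U : V → V → ℝ) (μ : V → ℝ),
      (∀ n i j, u n i ⬝ᵥ u n j = if i = j then 1 else 0) ∧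
      (∀ n i, A (φ n) *ᵥ u n i = ν n i • u n i) ∧
      (∀ i, Filter.Tendsto (fun n => u n i) Filter.atTop (nhds (U i))) ∧
      (∀ i, Filter.Tendsto (fun n => ν n i) Filter.atTop (nhds (μ i))) ∧
      (∀ i j, U i ⬝ᵥ U j = if i = j then 1 else 0) ∧ ∀ i, B *ᵥ U i = μ i • U i := by
  choose u ν hu hν using fun n => exists_orthonormal_eigenvectors (hA n)
  have hbound : ∀ n, u n ∈ Set.Icc (-1 : V → V → ℝ) 1 := by
    have habs : ∀ n i v, |u n i v| ≤ 1 := by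
      intro n i v
      rw [← sq_le_one_iff_abs_le_one]
      have h := hu n i i
      rw [if_pos rfl] at h
      rw [← h, dotProduct, sq]
      exact Finset.single_le_sum (f := fun v => u n i v * u n i v)
        (fun _ _ => mul_self_nonneg _) (Finset.mem_univ v)
    exact fun n => ⟨fun i v => (abs_le.mp (habs n i v)).1, fun i v => (abs_le.mp (habs n i v)).2⟩
  obtain ⟨U, -, φ, hφ, hlim⟩ := isCompact_Icc.tendsto_subseq hbound
  have hlim' : ∀ i, Filter.Tendsto (fun n => u (φ n) i) Filter.atTop (nhds (U i)) := fun i =>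
    (tendsto_pi_nhds.mp hlim) i
  have hAφ := hAB.comp hφ.tendsto_atTop
  have hdot : ∀ {x y : ℕ → V → ℝ} {a b : V → ℝ}, Filter.Tendsto x Filter.atTop (nhds a) →
      Filter.Tendsto y Filter.atTop (nhds b) →
      Filter.Tendsto (fun n => x n ⬝ᵥ y n) Filter.atTop (nhds (a ⬝ᵥ b)) := fun hx hy =>
    ((by fun_prop : Continuous fun p : (V → ℝ) × (V → ℝ) => p.1 ⬝ᵥ p.2).tendsto _).comp
      (hx.prodMk_nhds hy)
  have hmul : ∀ i, Filter.Tendsto (fun n => A (φ n) *ᵥ u (φ n) i) Filter.atTop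
      (nhds (B *ᵥ U i)) := fun i =>
    ((by fun_prop : Continuous fun p : Matrix V V ℝ × (V → ℝ) => p.1 *ᵥ p.2).tendsto _).comp
      (hAφ.prodMk_nhds (hlim' i))
  -- Eigenvalues are Rayleigh quotients, so they converge along with the eigenvectors.
  have hray : ∀ n i, ν n i = u n i ⬝ᵥ A n *ᵥ u n i := fun n i => by
    rw [hν, dotProduct_smul, hu, if_pos rfl, smul_eq_mul, mul_one]
  have hνlim : ∀ i, Filter.Tendsto (fun n => ν (φ n) i) Filter.atTop
      (nhds (U i ⬝ᵥ B *ᵥ U i)) := fun i => by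
    simp only [hray]
    exact hdot (hlim' i) (hmul i)
  refine ⟨φ, hφ, fun n => u (φ n), fun n => ν (φ n), U, fun i => U i ⬝ᵥ B *ᵥ U i,
    fun n => hu (φ n), fun n => hν (φ n), hlim', hνlim, fun i j => ?_, fun i => ?_⟩
  · refine tendsto_nhds_unique (hdot (hlim' i) (hlim' j)) ?_
    simp only [hu]
    exact tendsto_const_nhds
  · refine tendsto_nhds_unique (hmul i) ?_
    simp only [hν]
    exact (hνlim i).smul (hlim' i)

variable {M : Matrix V V ℝ} (hM : M.IsHermitian) {k m : ℕ}

/-- Since `eigenvalues₀` is non-increasing from index 0, λ_i sits at index n - i, and the copies of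
λ_k fill the indices n-(k+m-1), …, n-k. -/
theorem eigenvalues₀_cases (hk : 1 ≤ k) (hm : 1 ≤ m) (hkm : k + m - 1 ≤ Fintype.card V)
    (hlow : 1 < k → nthEigenvalue hM (k - 1) < nthEigenvalue hM k)
    (hmult : ∀ j < m, nthEigenvalue hM (k + j) = nthEigenvalue hM k)
    (hhigh : k + m ≤ Fintype.card V → nthEigenvalue hM (k + m - 1) < nthEigenvalue hM (k + m))
    (i : Fin (Fintype.card V)) :
    ((i : ℕ) < Fintype.card V - (k + m - 1) ∧ nthEigenvalue hM k < hM.eigenvalues₀ i) ∨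
    (Fintype.card V - (k + m - 1) ≤ i ∧ (i : ℕ) ≤ Fintype.card V - k ∧
      hM.eigenvalues₀ i = nthEigenvalue hM k) ∨
    (Fintype.card V - k < i ∧ hM.eigenvalues₀ i < nthEigenvalue hM k) := by
  have hi := i.2
  have hnth : ∀ j (h : 1 ≤ j ∧ j ≤ Fintype.card V),
      nthEigenvalue hM j = hM.eigenvalues₀ ⟨Fintype.card V - j, by omega⟩ := fun j h => dif_pos h
  rcases lt_or_ge (i : ℕ) (Fintype.card V - (k + m - 1)) with h1 | h1
  · refine .inl ⟨h1, ?_⟩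
    have hlt := hhigh (by omega)
    have heq := hmult (m - 1) (by omega)
    rw [← Nat.add_sub_assoc hm] at heq
    rw [heq, hnth (k + m) (by omega)] at hlt
    exact hlt.trans_le (hM.eigenvalues₀_antitone (Fin.mk_le_mk.mpr (by omega) :
      (⟨i, hi⟩ : Fin _) ≤ _))
  rcases le_or_gt (i : ℕ) (Fintype.card V - k) with h2 | h2
  · refine .inr (.inl ⟨h1, h2, ?_⟩)
    rw [← hmult (Fintype.card V - k - i) (by omega), hnth _ (by omega)]
    congr 1
    ext
    simp only
    omega
  · refine .inr (.inr ⟨h2, ?_⟩)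
    have hlt := hlow (by omega)
    rw [hnth (k - 1) (by omega)] at hlt
    exact (hM.eigenvalues₀_antitone (Fin.mk_le_mk.mpr (by omega) :
      _ ≤ (⟨i, hi⟩ : Fin _))).trans_lt hlt

theorem card_eigenvalues₀_gt (hk : 1 ≤ k) (hm : 1 ≤ m) (hkm : k + m - 1 ≤ Fintype.card V)
    (hlow : 1 < k → nthEigenvalue hM (k - 1) < nthEigenvalue hM k)
    (hmult : ∀ j < m, nthEigenvalue hM (k + j) = nthEigenvalue hM k)
    (hhigh : k + m ≤ Fintype.card V → nthEigenvalue hM (k + m - 1) < nthEigenvalue hM (k + m)) :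
    (Finset.univ.filter fun i => nthEigenvalue hM k < hM.eigenvalues₀ i).card =
      Fintype.card V - (k + m - 1) := by
  rw [show (Finset.univ.filter fun i => nthEigenvalue hM k < hM.eigenvalues₀ i) =
    Finset.univ.filter fun i : Fin (Fintype.card V) => (i : ℕ) < Fintype.card V - (k + m - 1) from
      Finset.filter_congr fun i _ => ?_]
  · rw [Fin.card_filter_val_lt]
    omega
  · rcases eigenvalues₀_cases hM hk hm hkm hlow hmult hhigh i with h | h | h
    · simp [h]
    · simp [h]
    · simp only [h.2.not_gt, false_iff]
      omega

theorem card_eigenvalues₀_eq (hk : 1 ≤ k) (hm : 1 ≤ m) (hkm : k + m - 1 ≤ Fintype.card V)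
    (hlow : 1 < k → nthEigenvalue hM (k - 1) < nthEigenvalue hM k)
    (hmult : ∀ j < m, nthEigenvalue hM (k + j) = nthEigenvalue hM k)
    (hhigh : k + m ≤ Fintype.card V → nthEigenvalue hM (k + m - 1) < nthEigenvalue hM (k + m)) :
    (Finset.univ.filter fun i => hM.eigenvalues₀ i = nthEigenvalue hM k).card = m := by
  have hn : 0 < Fintype.card V := by omega
  rw [show (Finset.univ.filter fun i => hM.eigenvalues₀ i = nthEigenvalue hM k) =
    Finset.Icc (⟨Fintype.card V - (k + m - 1), by omega⟩ : Fin (Fintype.card V))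
      ⟨Fintype.card V - k, by omega⟩ from Finset.ext fun i => ?_]
  · rw [Fin.card_Icc]
    simp only
    omega
  · simp only [Finset.mem_filter, Finset.mem_univ, true_and, Finset.mem_Icc, Fin.le_def]
    rcases eigenvalues₀_cases hM hk hm hkm hlow hmult hhigh i with h | h | h
    · simp only [h.2.ne', false_iff]
      omega
    · simp [h]
    · simp only [h.2.ne, false_iff]
      omega

/-- The dimension of an eigenspace is the number of occurrences of the eigenvalue along an
orthonormal eigenbasis. -/
theorem finrank_matrixEigenspace {U : V → V → ℝ} {μ : V → ℝ}
    (hM : M.IsSymm) (hU : ∀ i j, U i ⬝ᵥ U j = if i = j then 1 else 0)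
    (hMU : ∀ i, M *ᵥ U i = μ i • U i) (l : ℝ) :
    finrank ℝ (matrixEigenspace M l) = (Finset.univ.filter fun i => μ i = l).card := by
  let W : V → EuclideanSpace ℝ V := fun i => WithLp.toLp 2 (U i)
  have hW : Orthonormal ℝ W := orthonormal_iff_ite.mpr fun i j => by
    rw [EuclideanSpace.inner_eq_star_dotProduct]
    simpa [eq_comm, W] using hU j i
  have hspan : ⊤ ≤ Submodule.span ℝ (Set.range W) :=
    (hW.linearIndependent.span_eq_top_of_card_eq_finrank' (by simp)).ge
  let b := OrthonormalBasis.mk hW hspan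
  have hb : ∀ i, b i = W i := fun i => by simp [b]
  have heq : matrixEigenspace M l =
      Submodule.span ℝ (Set.range fun i : {i // μ i = l} => W i) := by
    apply le_antisymm
    · intro x hx
      have hx' : M *ᵥ x.ofLp = l • x.ofLp := by
        have := Module.End.mem_eigenspace_iff.mp hx
        simpa using congrArg WithLp.ofLp this
      rw [← b.sum_repr x]
      refine Submodule.sum_mem _ fun i _ => ?_
      by_cases hi : μ i = l
      · exact Submodule.smul_mem _ _ (Submodule.subset_span ⟨⟨i, hi⟩, (hb i).symm⟩)
      · have h0 : U i ⬝ᵥ x.ofLp = 0 := by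
          have h := dotProduct_mulVec_comm hM (U i) x.ofLp
          rw [hx', hMU, dotProduct_smul, smul_dotProduct, smul_eq_mul, smul_eq_mul] at h
          exact (mul_eq_zero.mp (by linarith : (μ i - l) * (U i ⬝ᵥ x.ofLp) = 0)).resolve_left
            (sub_ne_zero.mpr hi)
        have h1 : inner ℝ (W i) x = 0 := by
          rw [EuclideanSpace.inner_eq_star_dotProduct, dotProduct_comm]
          simpa [W] using h0
        rw [b.repr_apply_apply, hb, h1, zero_smul]
        exact Submodule.zero_mem _
    · rw [Submodule.span_le]
      rintro _ ⟨⟨i, hi⟩, rfl⟩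
      refine Module.End.mem_eigenspace_iff.mpr ?_
      ext v
      simpa [W, hi] using congrFun (hMU i) v
  rw [heq, ← Fintype.card_subtype]
  exact finrank_span_eq_card (hW.linearIndependent.comp _ Subtype.val_injective)

end Eigenbasis

/-! ### Leading-order asymptotics of the split eigenvalues. -/

section Asymptotics

open Filter Topology

/-- For i < j, cross-multiplying two relations eliminates ν and gives a_i b_j = t^{j-i} a_j b_i,
which tends to 0. So a'_i b'_j = 0, and a nonzero term of the sum singles out s. The limit is that
of σ a_s / b_s, rewritten with a'_s b'_s = 1. -/
theorem exists_leading_index {m : ℕ} {σ : ℝ} {t ν : ℕ → ℝ} {a b : ℕ → Fin m → ℝ}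
    {a' b' : Fin m → ℝ} (hσ : σ ≠ 0) (ht : ∀ n, 0 < t n) (ht0 : Tendsto t atTop (𝓝 0))
    (ha : ∀ i, Tendsto (fun n => a n i) atTop (𝓝 (a' i)))
    (hb : ∀ i, Tendsto (fun n => b n i) atTop (𝓝 (b' i)))
    (hab : ∑ i, a' i * b' i = 1)
    (hrel : ∀ n (i : Fin m), σ * t n ^ ((i : ℕ) + 1) * a n i = ν n * b n i) :
    ∃ s : Fin m, (∀ i < s, a' i = 0) ∧ (∀ i, s < i → b' i = 0) ∧ a' s * b' s = 1 ∧
      Tendsto (fun n => ν n / t n ^ ((s : ℕ) + 1)) atTop (𝓝 (σ * a' s ^ 2)) := by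
  have key : ∀ i j : Fin m, i < j → a' i * b' j = 0 := by
    intro i j hij
    have hlt : (i : ℕ) < j := hij
    have hlim : Tendsto (fun n => t n ^ ((j : ℕ) - i) * (a n j * b n i)) atTop
        (𝓝 (0 ^ ((j : ℕ) - i) * (a' j * b' i))) := (ht0.pow _).mul ((ha j).mul (hb i))
    rw [zero_pow (by omega), zero_mul] at hlim
    refine tendsto_nhds_unique ((ha i).mul (hb j)) (hlim.congr fun n => ?_)
    have hi := hrel n i
    have hj := hrel n j
    have hpow : t n ^ ((j : ℕ) + 1) = t n ^ ((i : ℕ) + 1) * t n ^ ((j : ℕ) - i) := by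
      rw [← pow_add]
      congr 1
      omega
    have h0 : σ * t n ^ ((i : ℕ) + 1) ≠ 0 := mul_ne_zero hσ (pow_pos (ht n) _).ne'
    apply mul_left_cancel₀ h0
    rw [hpow] at hj
    linear_combination b n i * hj - b n j * hi
  obtain ⟨s, -, hs⟩ := Finset.exists_ne_zero_of_sum_ne_zero (hab.trans_ne one_ne_zero)
  have h1 : ∀ i < s, a' i = 0 := fun i hi =>
    (mul_eq_zero.mp (key i s hi)).resolve_right (right_ne_zero_of_mul hs)
  have h2 : ∀ i, s < i → b' i = 0 := fun i hi =>
    (mul_eq_zero.mp (key s i hi)).resolve_left (left_ne_zero_of_mul hs)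
  have h3 : a' s * b' s = 1 := by
    rw [← hab]
    symm
    refine Finset.sum_eq_single s (fun i _ hi => ?_) fun h => absurd (Finset.mem_univ s) h
    rcases lt_or_gt_of_ne hi with h | h
    · rw [h1 i h, zero_mul]
    · rw [h2 i h, mul_zero]
  have hbs : b' s ≠ 0 := right_ne_zero_of_mul hs
  refine ⟨s, h1, h2, h3, ?_⟩
  have hval : σ * a' s ^ 2 = σ * (a' s / b' s) := by
    rw [div_eq_mul_inv, ← eq_inv_of_mul_eq_one_left h3, sq]
  rw [hval]
  refine Tendsto.congr' ?_ (((ha s).div (hb s) hbs).const_mul σ)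
  filter_upwards [(hb s).eventually_ne hbs] with n hn
  have := hrel n s
  have htn := (pow_pos (ht n) ((s : ℕ) + 1)).ne'
  rw [Pi.div_apply, ← mul_div_assoc, div_eq_div_iff hn htn]
  linear_combination this

theorem tendsto_div_pow_zero_of_lt {t x : ℕ → ℝ} {c : ℝ} {i j : ℕ} (ht : ∀ n, 0 < t n)
    (ht0 : Tendsto t atTop (𝓝 0)) (hx : Tendsto (fun n => x n / t n ^ (j + 1)) atTop (𝓝 c))
    (hij : i < j) : Tendsto (fun n => x n / t n ^ (i + 1)) atTop (𝓝 0) := by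
  have h := hx.mul (ht0.pow (j - i))
  rw [zero_pow (by omega), mul_zero] at h
  refine h.congr fun n => ?_
  have h1 : t n ^ (j + 1) = t n ^ (i + 1) * t n ^ (j - i) := by
    rw [← pow_add]
    congr 1
    omega
  have := (ht n).ne'
  rw [h1]
  field_simp

/-- The smaller power of t dominates: for σ > 0 it belongs to y, which is positive there, and for σ
< 0 to x, which is negative. -/
theorem eventually_lt_of_tendsto_div_pow {σ : ℝ} {t x y : ℕ → ℝ} {α β : ℝ} {i j : ℕ}
    (ht : ∀ n, 0 < t n) (ht0 : Tendsto t atTop (𝓝 0)) (hα : 0 < α) (hβ : 0 < β)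
    (hx : Tendsto (fun n => x n / t n ^ (j + 1)) atTop (𝓝 (σ * α)))
    (hy : Tendsto (fun n => y n / t n ^ (i + 1)) atTop (𝓝 (σ * β)))
    (hij : 0 < σ * ((j : ℝ) - i)) : ∀ᶠ n in atTop, x n < y n := by
  have main : ∀ {l : ℕ} {c : ℝ}, 0 < c →
      Tendsto (fun n => y n / t n ^ (l + 1) - x n / t n ^ (l + 1)) atTop (𝓝 c) →
      ∀ᶠ n in atTop, x n < y n := by
    intro l c hc h
    filter_upwards [h.eventually (lt_mem_nhds hc)] with n hn
    exact (div_lt_div_iff_of_pos_right (pow_pos (ht n) (l + 1))).mp (sub_pos.mp hn)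
  rcases pos_and_pos_or_neg_and_neg_of_mul_pos hij with ⟨hσ, h⟩ | ⟨hσ, h⟩
  · have hlt : i < j := by exact_mod_cast sub_pos.mp h
    have := hy.sub (tendsto_div_pow_zero_of_lt ht ht0 hx hlt)
    rw [sub_zero] at this
    exact main (mul_pos hσ hβ) this
  · have hlt : j < i := by exact_mod_cast sub_neg.mp h
    have := (tendsto_div_pow_zero_of_lt ht ht0 hy hlt).sub hx
    rw [zero_sub] at this
    exact main (neg_pos.mpr (mul_neg_of_neg_of_pos hσ hα)) this

end Asymptotics

/-! ### Splitting a multiple eigenvalue by a diagonal perturbation. -/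

section Perturbation

open Filter Topology

variable {V : Type*} [Fintype V] {G : SimpleGraph V}

theorem linearIndependent_of_dotProduct {ι : Type*} [Fintype ι] [DecidableEq ι] {U : ι → V → ℝ}
    (hU : ∀ i j, U i ⬝ᵥ U j = if i = j then 1 else 0) : LinearIndependent ℝ U := by
  rw [Fintype.linearIndependent_iff]
  intro a ha i
  have := congrArg (· ⬝ᵥ U i) ha
  simpa [sum_dotProduct, hU] using this

theorem sum_smul_dotProduct_sum_smul {ι : Type*} [Fintype ι] [DecidableEq ι] {U : ι → V → ℝ}
    (hU : ∀ i j, U i ⬝ᵥ U j = if i = j then 1 else 0) (a b : ι → ℝ) :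
    (∑ i, a i • U i) ⬝ᵥ (∑ i, b i • U i) = ∑ i, a i * b i := by
  simp [sum_dotProduct, dotProduct_sum, hU, mul_comm]

variable [DecidableEq V]

/-- An eigenvector has Urschel number at most the number of eigenvalues that are not larger than
its own. -/
theorem urschelNumber_eigenvector_add_card_le (hG : G.Connected) {A : Matrix V V ℝ}
    (hA : IsGeneralizedLaplacian G A) {U : V → V → ℝ} {μ : V → ℝ}
    (hU : ∀ i j, U i ⬝ᵥ U j = if i = j then 1 else 0) (hAU : ∀ i, A *ᵥ U i = μ i • U i)
    (κ : V) (P : Finset V) (hP : ∀ i ∈ P, μ κ < μ i) :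
    urschelNumber G (U κ) + P.card ≤ Fintype.card V := by
  -- The smallest eigenvalue gap serves as the uniform constant; any positive number does when `P`
  -- is empty.
  obtain ⟨c, hc, hcP⟩ : ∃ c > 0, ∀ i ∈ P, c ≤ μ i - μ κ := by
    rcases P.eq_empty_or_nonempty with rfl | hne
    · exact ⟨1, one_pos, by simp⟩
    · obtain ⟨i, hi, hmin⟩ := P.exists_min_image (fun i => μ i - μ κ) hne
      exact ⟨_, sub_pos.mpr (hP i hi), hmin⟩
  have hsub : ∀ i, (A + diagonal fun _ => -μ κ) *ᵥ U i = (μ i - μ κ) • U i := fun i => by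
    rw [add_mulVec, hAU]
    ext v
    rw [Pi.add_apply, mulVec_diagonal]
    simp only [Pi.smul_apply, smul_eq_mul]
    ring
  have hUP : ∀ i j : P, U i ⬝ᵥ U j = if i = j then 1 else 0 := fun i j => by
    rw [hU]
    simp only [Subtype.ext_iff]
  have h := urschelNumber_add_finrank_le hG (hA.add_diagonal fun _ => -μ κ) (f := U κ)
    (fun h => by simpa [h] using hU κ κ) (by rw [hsub, sub_self, zero_smul])
    (Submodule.span ℝ (Set.range fun i : P => U i)) hc ?_
  · rwa [finrank_span_eq_card (linearIndependent_of_dotProduct hUP), Fintype.card_coe] at h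
  · intro x hx
    obtain ⟨a, rfl⟩ := (Submodule.mem_span_range_iff_exists_fun ℝ).mp hx
    have himg : (A + diagonal fun _ => -μ κ) *ᵥ (∑ i : P, a i • U i) =
        ∑ i : P, (a i * (μ i - μ κ)) • U i := by
      rw [mulVec_sum]
      exact Finset.sum_congr rfl fun i _ => by rw [mulVec_smul, hsub, smul_smul]
    rw [himg, sum_smul_dotProduct_sum_smul hUP, sum_smul_dotProduct_sum_smul hUP, Finset.mul_sum]
    refine Finset.sum_le_sum fun i _ => ?_
    nlinarith [mul_le_mul_of_nonneg_left (hcP i i.2) (mul_self_nonneg (a i))]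

/-- The weights `t, t ^ 2, …` placed at the vertices `p 0, p 1, …`. -/
def powerWeights {m : ℕ} (p : Fin m → V) (t : ℝ) (w : V) : ℝ :=
  ∑ i : Fin m, if p i = w then t ^ ((i : ℕ) + 1) else 0

theorem dotProduct_diagonal_powerWeights_mulVec {m : ℕ} (p : Fin m → V) (t : ℝ) (x y : V → ℝ) :
    x ⬝ᵥ diagonal (powerWeights p t) *ᵥ y = ∑ i : Fin m, t ^ ((i : ℕ) + 1) * x (p i) * y (p i) := by
  simp only [dotProduct, mulVec_diagonal, powerWeights, Finset.sum_mul, Finset.mul_sum]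
  rw [Finset.sum_comm]
  refine Finset.sum_congr rfl fun i _ => ?_
  rw [Finset.sum_eq_single (p i) (fun w _ hw => by simp [hw.symm]) (by simp), if_pos rfl]
  ring

/-- Bases of an eigenspace obtained as limits of eigenvectors along a diagonal perturbation
with weights of different orders of magnitude. -/
theorem exists_limit_eigenvectors (hG : G.Connected) {M : Matrix V V ℝ}
    (hM : IsGeneralizedLaplacian G M) {l : ℝ} {m q : ℕ} (p : Fin m → V) (h : Fin m → V → ℝ)
    (hMh : ∀ i, M *ᵥ h i = l • h i) (hδ : ∀ i j, h i (p j) = if i = j then 1 else 0)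
    (hexp : ∀ x, M *ᵥ x = l • x → x = ∑ i, x (p i) • h i)
    (hcount : ∀ (U : V → V → ℝ) (μ : V → ℝ), (∀ i j, U i ⬝ᵥ U j = if i = j then 1 else 0) →
      (∀ i, M *ᵥ U i = μ i • U i) → (Finset.univ.filter fun i => l < μ i).card = q ∧
        (Finset.univ.filter fun i => μ i = l).card = m)
    {σ : ℝ} (hσ : σ ≠ 0) :
    ∃ F : Fin m → V → ℝ, (∀ i j, F i ⬝ᵥ F j = if i = j then 1 else 0) ∧
      (∀ j, M *ᵥ F j = l • F j) ∧ (∀ j, ∀ i < j, F j (p i) = 0) ∧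
      (∀ j i, j < i → h i ⬝ᵥ F j = 0) ∧
      ∀ j, urschelNumber G (F j) +
        (q + (Finset.univ.filter fun i : Fin m => 0 < σ * ((j : ℝ) - i)).card) ≤
          Fintype.card V := by
  let d : ℕ → V → ℝ := fun n => σ • powerWeights p (1 / ((n : ℝ) + 1))
  have hlap : ∀ n, IsGeneralizedLaplacian G (M + diagonal (d n)) := fun n => hM.add_diagonal _
  have hlim : Tendsto (fun n => M + diagonal (d n)) atTop (𝓝 M) := by
    have hd : Tendsto d atTop (𝓝 0) := by
      have hc : Continuous fun t : ℝ => σ • powerWeights p t := by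
        refine Continuous.const_smul (continuous_pi fun w => ?_) σ
        refine continuous_finsetSum _ fun i _ => ?_
        split_ifs <;> fun_prop
      -- The exponents start at 1, so all weights vanish at t = 0.
      have h0 : σ • powerWeights p 0 = 0 := by
        ext w
        simp [powerWeights]
      exact h0 ▸ (hc.tendsto 0).comp tendsto_one_div_add_atTop_nhds_zero_nat
    have hc : Continuous fun x : V → ℝ => M + diagonal x := by fun_prop
    have h := (hc.tendsto 0).comp hd
    rw [diagonal_zero', add_zero] at h
    exact h
  obtain ⟨φ, hφ, u, ν, U, μ, hu, hν, huU, hνμ, hU, hMU⟩ :=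
    exists_subseq_tendsto_eigenvectors (fun n => (hlap n).isHermitian) hlim
  obtain ⟨hgt, heq⟩ := hcount U μ hU hMU
  let t : ℕ → ℝ := fun n => 1 / ((φ n : ℝ) + 1)
  have ht : ∀ n, 0 < t n := fun n => by positivity
  have ht0 : Tendsto t atTop (𝓝 0) :=
    tendsto_one_div_add_atTop_nhds_zero_nat.comp hφ.tendsto_atTop
  -- Pair the perturbed eigenvalue equation with `h i`: duality with the points `p` leaves only the
  -- weight at `p i`.
  have hrel : ∀ c n (i : Fin m), σ * t n ^ ((i : ℕ) + 1) * u n c (p i) = (ν n c - l) * (h i ⬝ᵥ u n c) := by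
    intro c n i
    have h1 : h i ⬝ᵥ (M + diagonal (d (φ n))) *ᵥ u n c =
        l * (h i ⬝ᵥ u n c) + σ * (t n ^ ((i : ℕ) + 1) * u n c (p i)) := by
      rw [add_mulVec, dotProduct_add, dotProduct_mulVec_comm hM.symm, hMh, smul_dotProduct,
        smul_eq_mul, diagonal_smul, smul_mulVec, dotProduct_smul,
        dotProduct_diagonal_powerWeights_mulVec, smul_eq_mul]
      congr 2
      rw [Finset.sum_eq_single i (fun j _ hj => by simp [hδ, hj.symm]) (by simp), hδ, if_pos rfl,
        mul_one]
    rw [hν, dotProduct_smul, smul_eq_mul] at h1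
    linear_combination -h1
  have hsum : ∀ x y, M *ᵥ x = l • x → ∑ i, x (p i) * (h i ⬝ᵥ y) = x ⬝ᵥ y := fun x y hx => by
    conv_rhs => rw [hexp x hx, sum_dotProduct]
    simp
  have hlead : ∀ c : {c // μ c = l}, ∃ s : Fin m, (∀ i < s, U c (p i) = 0) ∧
      (∀ i, s < i → h i ⬝ᵥ U c = 0) ∧ U c (p s) * (h s ⬝ᵥ U c) = 1 ∧
      Tendsto (fun n => (ν n c - l) / t n ^ ((s : ℕ) + 1)) atTop (𝓝 (σ * U c (p s) ^ 2)) := by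
    intro c
    refine exists_leading_index hσ ht ht0 (a := fun n i => u n c (p i))
      (b := fun n i => h i ⬝ᵥ u n c) (fun i => (tendsto_pi_nhds.mp (huU c)) (p i)) (fun i => ?_) ?_
      (hrel c)
    · exact ((by fun_prop : Continuous fun y => h i ⬝ᵥ y).tendsto _).comp (huU c)
    · rw [hsum (U c) (U c) (by rw [hMU, c.2]), hU, if_pos rfl]
  choose s hs1 hs2 hs3 hs4 using hlead
  -- If two limits shared a leading index, their inner product would reduce to a single nonzero
  -- term, against orthogonality.
  have hinj : Function.Injective s := by
    intro c c' hcc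
    by_contra hne
    have h0 : U c ⬝ᵥ U c' = 0 := by
      rw [hU, if_neg fun h => hne (Subtype.ext h)]
    rw [← hsum (U c) (U c') (by rw [hMU, c.2]), Finset.sum_eq_single (s c) (fun i _ hi => ?_)
      (by simp)] at h0
    · refine mul_ne_zero (left_ne_zero_of_mul_eq_one (hs3 c)) ?_ h0
      rw [hcc]
      exact right_ne_zero_of_mul_eq_one (hs3 c')
    · rcases lt_or_gt_of_ne hi with hlt | hlt
      · rw [hs1 c i hlt, zero_mul]
      · rw [hs2 c' i (hcc ▸ hlt), mul_zero]
  let e : {c // μ c = l} ≃ Fin m := Equiv.ofBijective s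
    ((Fintype.bijective_iff_injective_and_card s).mpr
      ⟨hinj, by rw [Fintype.card_subtype, heq, Fintype.card_fin]⟩)
  have he : ∀ j, s (e.symm j) = j := fun j => e.apply_symm_apply j
  refine ⟨fun j => U (e.symm j), fun i j => ?_, fun j => ?_, fun j i hij => ?_, fun j i hij => ?_,
    fun j => ?_⟩
  · rw [hU]
    simp [Subtype.ext_iff.symm]
  · rw [hMU, (e.symm j).2]
  · exact hs1 _ i (by rwa [he])
  · exact hs2 _ i (by rwa [he])
  · set c := e.symm j with hc
    -- `P` collects the eigenvalues already above `l` in the limit, `Q` those tending to `l` that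
    -- the perturbation places above the one leading to `U c`.
    let P : Finset V := Finset.univ.filter fun i => l < μ i
    let Q : Finset V := (Finset.univ.filter fun i : Fin m => 0 < σ * ((j : ℝ) - i)).map
      (e.symm.toEmbedding.trans (Function.Embedding.subtype _))
    have hdisj : Disjoint P Q := by
      rw [Finset.disjoint_left]
      intro i hi hiQ
      obtain ⟨a, -, rfl⟩ := Finset.mem_map.mp hiQ
      exact (Finset.mem_filter.mp hi).2.ne' (e.symm a).2
    have hcard : (P ∪ Q).card =
        q + (Finset.univ.filter fun i : Fin m => 0 < σ * ((j : ℝ) - i)).card := by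
      rw [Finset.card_union_of_disjoint hdisj, Finset.card_map, hgt]
    have hsq : ∀ c : {c // μ c = l}, 0 < U c (p (s c)) ^ 2 := fun c =>
      sq_pos_of_ne_zero (left_ne_zero_of_mul_eq_one (hs3 c))
    have hev1 : ∀ᶠ n in atTop, ∀ i ∈ P ∪ Q, ν n c < ν n i := by
      rw [Finset.eventually_all]
      intro i hi
      rcases Finset.mem_union.mp hi with hi | hi
      · refine (hνμ c).eventually_lt (hνμ i) ?_
        rw [c.2]
        exact (Finset.mem_filter.mp hi).2
      · obtain ⟨a, ha, rfl⟩ := Finset.mem_map.mp hi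
        have hlt := (Finset.mem_filter.mp ha).2
        have := eventually_lt_of_tendsto_div_pow ht ht0 (hsq c) (hsq (e.symm a)) (hs4 c)
          (hs4 (e.symm a)) (by rw [hc, he, he]; exact hlt)
        filter_upwards [this] with n hn
        exact (sub_lt_sub_iff_right l).mp hn
    have hev2 : ∀ᶠ n in atTop, ∀ v, (0 < U c v → 0 < u n c v) ∧ (U c v < 0 → u n c v < 0) := by
      rw [eventually_all]
      intro v
      have hv := (tendsto_pi_nhds.mp (huU c)) v
      rw [eventually_and, eventually_imp_distrib_left, eventually_imp_distrib_left]
      exact ⟨fun h0 => hv.eventually (lt_mem_nhds h0), fun h0 => hv.eventually (gt_mem_nhds h0)⟩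
    obtain ⟨n, hn1, hn2⟩ := (hev1.and hev2).exists
    rw [← hcard]
    exact (Nat.add_le_add_right (urschelNumber_le_of_sign_compatible (fun v => (hn2 v).1)
      fun v => (hn2 v).2) _).trans
      (urschelNumber_eigenvector_add_card_le hG (hlap (φ n)) (hu n) (hν n) c (P ∪ Q) hn1)

end Perturbation

/-! ### Invariance under nonzero scalars. -/

section Scaling

variable {V : Type*}

theorem strongNodalDomainNumber_neg (G : SimpleGraph V) (g : V → ℝ) :
    strongNodalDomainNumber G (-g) = strongNodalDomainNumber G g := by
  have h1 : {v | 0 < (-g) v} = {v | g v < 0} := by ext; simp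
  have h2 : {v | (-g) v < 0} = {v | 0 < g v} := by ext; simp
  rw [strongNodalDomainNumber, strongNodalDomainNumber, h1, h2, add_comm]

theorem urschelNumber_neg_le (G : SimpleGraph V) (f : V → ℝ) :
    urschelNumber G (-f) ≤ urschelNumber G f := by
  obtain ⟨s, hs, hd⟩ := Nat.sInf_mem (s := {d : ℕ | ∃ s : V → ℝ, IsSigning f s ∧
    d = strongNodalDomainNumber G s})
    ((exists_isSigning f).elim fun s hs => ⟨_, s, hs, rfl⟩)
  rw [urschelNumber.eq_1 G f, hd, ← strongNodalDomainNumber_neg]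
  exact urschelNumber_le_of_isSigning
    ⟨fun v hv => by simpa using hs.neg v (by simpa using hv),
      fun v hv => by simpa using hs.pos v (by simpa using hv), fun v => by simpa using hs.ne_zero v⟩

/-- A negative factor merely exchanges positive and negative nodal domains. The factor relating the
two limit bases has unknown sign. -/
theorem urschelNumber_smul_le (G : SimpleGraph V) (f : V → ℝ) (c : ℝ) (hc : c ≠ 0) :
    urschelNumber G (c • f) ≤ urschelNumber G f := by
  rcases lt_or_gt_of_ne hc with hc | hc
  · refine (urschelNumber_le_of_sign_compatible (g := -f) (fun v hv => ?_) fun v hv => ?_).trans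
      (urschelNumber_neg_le G f)
    · simpa using neg_of_mul_pos_right (a := c) hv hc.le
    · simpa using pos_of_mul_neg_right (a := c) hv hc.le
  · exact urschelNumber_le_of_sign_compatible (fun v hv => pos_of_mul_pos_right (a := c) hv hc.le)
      fun v hv => neg_of_mul_neg_right (a := c) hv hc.le

end Scaling

/-! ### Combining the perturbations with σ = 1 and σ = -1. -/

theorem mainTheorem1 {V : Type*} [Fintype V] [DecidableEq V]
    (G : SimpleGraph V) (hG : G.Connected)
    (M : Matrix V V ℝ) (hM : IsGeneralizedLaplacian G M)
    (k m : ℕ) (hk : 1 ≤ k) (hm : 1 ≤ m) (hkm : k + m - 1 ≤ Fintype.card V)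
    (hlow : 1 < k → nthEigenvalue hM.isHermitian (k - 1) < nthEigenvalue hM.isHermitian k)
    (hmult : ∀ j < m, nthEigenvalue hM.isHermitian (k + j) = nthEigenvalue hM.isHermitian k)
    (hhigh : k + m ≤ Fintype.card V →
      nthEigenvalue hM.isHermitian (k + m - 1) < nthEigenvalue hM.isHermitian (k + m)) :
    ∃ f : OrthonormalBasis (Fin m) ℝ (matrixEigenspace M (nthEigenvalue hM.isHermitian k)),
      ∀ j : Fin m,
        urschelNumber G (fun v => (f j : EuclideanSpace ℝ V) v) ≤
          k + min (j : ℕ) (m - 1 - (j : ℕ)) := by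
  have hcount : ∀ (U : V → V → ℝ) (μ : V → ℝ), (∀ i j, U i ⬝ᵥ U j = if i = j then 1 else 0) →
      (∀ i, M *ᵥ U i = μ i • U i) →
      (Finset.univ.filter fun i => nthEigenvalue hM.isHermitian k < μ i).card =
        Fintype.card V - (k + m - 1) ∧
      (Finset.univ.filter fun i => μ i = nthEigenvalue hM.isHermitian k).card = m := by
    intro U μ hU hMU
    exact ⟨(card_filter_eigenvalues₀ hM.isHermitian hU hMU fun x => _ < x).trans
        (card_eigenvalues₀_gt hM.isHermitian hk hm hkm hlow hmult hhigh),
      (card_filter_eigenvalues₀ hM.isHermitian hU hMU fun x => x = _).trans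
        (card_eigenvalues₀_eq hM.isHermitian hk hm hkm hlow hmult hhigh)⟩
  set l := nthEigenvalue hM.isHermitian k with hl
  have hmem : ∀ x : EuclideanSpace ℝ V, x ∈ matrixEigenspace M l ↔ M *ᵥ x.ofLp = l • x.ofLp := by
    intro x
    rw [matrixEigenspace, Module.End.mem_eigenspace_iff, ← (WithLp.ofLp_injective 2).eq_iff]
    simp
  have hdim : finrank ℝ (matrixEigenspace M l) = m := by
    obtain ⟨U, μ, hU, hMU⟩ := exists_orthonormal_eigenvectors hM.isHermitian
    exact (finrank_matrixEigenspace hM.symm hU hMU l).trans (hcount U μ hU hMU).2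
  obtain ⟨p, h, hδ, hexp⟩ := exists_interpolation_basis hdim
    ((WithLp.linearEquiv 2 ℝ (V → ℝ)).toLinearMap ∘ₗ (matrixEigenspace M l).subtype)
    ((WithLp.linearEquiv 2 ℝ (V → ℝ)).injective.comp (Submodule.injective_subtype _))
  have hMh : ∀ i, M *ᵥ (h i : EuclideanSpace ℝ V).ofLp = l • (h i : EuclideanSpace ℝ V).ofLp :=
    fun i => (hmem _).mp (h i).2
  have hexp' : ∀ x : V → ℝ, M *ᵥ x = l • x →
      x = ∑ i, x (p i) • (h i : EuclideanSpace ℝ V).ofLp := by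
    intro x hx
    have := congrArg (fun y : matrixEigenspace M l => (y : EuclideanSpace ℝ V).ofLp)
      (hexp ⟨WithLp.toLp 2 x, (hmem _).mpr hx⟩)
    simpa using this
  have hsum : ∀ x y, M *ᵥ x = l • x →
      ∑ i, x (p i) * ((h i : EuclideanSpace ℝ V).ofLp ⬝ᵥ y) = x ⬝ᵥ y := fun x y hx => by
    conv_rhs => rw [hexp' x hx, sum_dotProduct]
    simp
  obtain ⟨F, hF, hMF, hF1, hF2, hF3⟩ := exists_limit_eigenvectors hG hM p
    (fun i => (h i : EuclideanSpace ℝ V).ofLp) hMh hδ hexp' hcount one_ne_zero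
  obtain ⟨F', hF', hMF', hF1', hF2', hF3'⟩ := exists_limit_eigenvectors hG hM p
    (fun i => (h i : EuclideanSpace ℝ V).ofLp) hMh hδ hexp' hcount (neg_ne_zero.mpr one_ne_zero)
  have hlead : ∀ j, F' j (p j) ≠ 0 := by
    intro j h0
    have := hsum (F' j) (F' j) (hMF' j)
    rw [hF', if_pos rfl, Finset.sum_eq_zero fun i _ => ?_] at this
    · exact zero_ne_one this
    · rcases lt_trichotomy i j with hij | rfl | hij
      · rw [hF1' j i hij, zero_mul]
      · rw [h0, zero_mul]
      · rw [hF2' j i hij, mul_zero]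
  have hsmul : ∀ j, ∃ c : ℝ, c ≠ 0 ∧ F j = c • F' j := by
    intro j
    -- The difference vanishes at `p i` for i ≤ j and is orthogonal to `h i` for i > j, so every
    -- term of its squared norm in `hsum` is zero.
    have heq : F j - (F j (p j) / F' j (p j)) • F' j = 0 := by
      rw [← dotProduct_self_eq_zero, ← hsum]
      · refine Finset.sum_eq_zero fun i _ => ?_
        rcases lt_trichotomy i j with hij | rfl | hij
        · simp [hF1 j i hij, hF1' j i hij]
        · simp [div_mul_cancel₀ _ (hlead i)]
        · rw [dotProduct_sub, dotProduct_smul, hF2 j i hij, hF2' j i hij, smul_zero, sub_zero,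
            mul_zero]
      · rw [mulVec_sub, mulVec_smul, hMF, hMF', smul_sub, smul_comm]
    refine ⟨_, fun h0 => ?_, sub_eq_zero.mp heq⟩
    rw [h0, zero_smul, sub_zero] at heq
    simpa [heq] using hF j j
  let f : Fin m → matrixEigenspace M l := fun j => ⟨WithLp.toLp 2 (F j), (hmem _).mpr (hMF j)⟩
  have hf : Orthonormal ℝ f := orthonormal_iff_ite.mpr fun i j => by
    rw [Submodule.coe_inner, EuclideanSpace.inner_eq_star_dotProduct]
    simpa [f, eq_comm] using hF j i
  refine ⟨OrthonormalBasis.mk hf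
    (hf.linearIndependent.span_eq_top_of_card_eq_finrank' (by simp [hdim])).ge, fun j => ?_⟩
  have hfun : (fun v => ((OrthonormalBasis.mk hf
      (hf.linearIndependent.span_eq_top_of_card_eq_finrank' (by simp [hdim])).ge) j :
        EuclideanSpace ℝ V) v) = F j := by
    simp [f]
  rw [hfun]
  have hj := j.2
  have h1 := hF3 j
  have h2 := hF3' j
  -- These counts are j and m-1-j. Together with the n-(k+m-1) larger eigenvalues they give the
  -- bounds k+m-1-j and k+j.
  have hc1 : (Finset.univ.filter fun i : Fin m => (0 : ℝ) < 1 * ((j : ℝ) - i)) = Finset.Iio j := by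
    ext i
    simp
  have hc2 : (Finset.univ.filter fun i : Fin m => (0 : ℝ) < -1 * ((j : ℝ) - i)) =
      Finset.Ioi j := by
    ext i
    simp
  rw [hc1, Fin.card_Iio] at h1
  rw [hc2, Fin.card_Ioi] at h2
  obtain ⟨c, hc, hFc⟩ := hsmul j
  have h3 := urschelNumber_smul_le G (F' j) c hc
  rw [← hFc] at h3
  omega
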